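/- Let $X$ be an affine irreducible variety over $\mathbb C$ with ring of regular functions $\mathcal O_X$, and let $\mathcal F$ be an algebraic foliation on $X$, i.e. a set of $\mathbb C$-derivations of $\mathcal O_X$ stable under the Lie bracket. For a point $x\in X$ let $I(\mathcal F,x)$ be the largest ideal $I$ of $\mathcal O_X$ such that every $f\in I$ vanishes at $x$ and $\partial(I)\subseteq I$ for all $\partial\in\mathcal F$. Let $V(\mathcal F,x)\subseteq X$ be the zero set of $I(\mathcal F,x)$, and put $n_{\mathcal F}(x)=\dim V(\mathcal F,x)\in\mathbb N$. Then $n_{\mathcal F}:X\to\mathbb N$ is measurable for the Zariski topology: for every $d\in\mathbb N$ the set $n_{\mathcal F}^{-1}(d)$ belongs to the $\sigma$-algebra generated by the Zariski open subsets of $X$. Moreover there exists an integer $p\ge 0$ such that (1) $n_{\mathcal F}(x)\le p$ for every $x\in X$, and (2) $n_{\mathcal F}(x)=p$ for every very generic point $x$, i.e. for every $x$ in some countable intersection of nonempty Zariski open subsets of $X$. The value $p$ is attained, so $p=\max_{x\in X} n_{\mathcal F}(x)$. -/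

import Mathlib

/-!
Conventions. An affine irreducible variety `X` over `ℂ` is given by its ring of regular functions
`A = 𝒪_X`, a finitely generated `ℂ`-algebra which is an integral domain. The points of `X` are the
maximal ideals of `A` (`MaximalSpectrum A`, with Mathlib's Zariski topology), and a function `f : A`
vanishes at the point `x` if and only if `f ∈ x.asIdeal`.
-/

/-- An algebraic foliation on the affine variety with ring of regular functions `A`: a collection of
algebraic vector fields (`ℂ`-derivations of `A`) which is stable under the Lie bracket. -/
structure AlgebraicFoliation (A : Type*) [CommRing A] [Algebra ℂ A] where
  /-- the vector fields of the foliation -/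
  carrier : Set (Derivation ℂ A A)
  lie_mem : ∀ D₁ ∈ carrier, ∀ D₂ ∈ carrier, ⁅D₁, D₂⁆ ∈ carrier

/-- The ideal `I_Y` of the regular functions that vanish at every point of `Y`. -/
def pointsIdeal {A : Type*} [CommRing A] (Y : Set (MaximalSpectrum A)) : Ideal A :=
  ⨅ y ∈ Y, y.asIdeal

/-- The zero set in `X` of an ideal `I` of regular functions. -/
def zeroSet {A : Type*} [CommRing A] (I : Ideal A) : Set (MaximalSpectrum A) :=
  {x | ∀ f ∈ I, f ∈ x.asIdeal}

namespace AlgebraicFoliation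

variable {A : Type*} [CommRing A] [Algebra ℂ A]

/-- The set of the ideals contained in `I_Y` and stable under every vector field of `F`. -/
def invariantIdeals (F : AlgebraicFoliation A) (Y : Set (MaximalSpectrum A)) : Set (Ideal A) :=
  {I | I ≤ pointsIdeal Y ∧ ∀ D ∈ F.carrier, ∀ f ∈ I, D f ∈ I}

/-- The ideal `I(F, Y)`: the largest ideal contained in `I_Y` and stable under `F`. -/
def maxIdeal (F : AlgebraicFoliation A) (Y : Set (MaximalSpectrum A)) : Ideal A :=
  sSup (F.invariantIdeals Y)

/-- `I(F, Y)` is indeed the greatest element of the set of invariant ideals. -/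
theorem isGreatest_maxIdeal (F : AlgebraicFoliation A) (Y : Set (MaximalSpectrum A)) :
    IsGreatest (F.invariantIdeals Y) (F.maxIdeal Y) := by
  refine ⟨⟨sSup_le fun I hI => hI.1, fun D hD f hf => ?_⟩, fun I hI => le_sSup hI⟩
  unfold maxIdeal at hf ⊢
  rw [sSup_eq_iSup'] at hf ⊢
  induction hf using Submodule.iSup_induction' with
  | mem I f hf => exact (le_iSup (fun J : F.invariantIdeals Y => (J : Ideal A)) I) (I.2.2 D hD f hf)
  | zero => simp
  | add f g _ _ hf hg => rw [map_add]; exact Ideal.add_mem _ hf hg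

/-- The minimal invariant variety `V(F, Y)`. -/
def minimalInvariantVariety (F : AlgebraicFoliation A) (Y : Set (MaximalSpectrum A)) :
    Set (MaximalSpectrum A) :=
  zeroSet (F.maxIdeal Y)

end AlgebraicFoliation

/-- A function with values in `ℕ` is measurable for the Zariski topology if its fibres belong to the
`σ`-algebra generated by the Zariski open sets. -/
def ZariskiMeasurable {X : Type*} [TopologicalSpace X] (n : X → ℕ) : Prop :=
  ∀ d : ℕ, @MeasurableSet X (MeasurableSpace.generateFrom {U : Set X | IsOpen U}) (n ⁻¹' {d})

/-- `P` holds at every very generic point: it holds at all the points of some countable intersection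
of nonempty open sets. -/
def VeryGenerically {X : Type*} [TopologicalSpace X] (P : X → Prop) : Prop :=
  ∃ U : ℕ → Set X, (∀ i, IsOpen (U i) ∧ (U i).Nonempty) ∧ ∀ x ∈ ⋂ i, U i, P x

/-! Fix generators `g` of `A`. The dimension of `V(F, x)` is the Krull dimension of `A ⧸ I(F, x)`,
which is the largest size of a subfamily of `g` that stays algebraically independent modulo `I(F,
x)`.

A function lies in `I(F, x)` exactly when all its iterated derivatives along `F` vanish at `x`. So a
subfamily `s` is independent at `x` when, for each degree bound `N`, no nonzero polynomial of degree
at most `N` in `s` has all its derivatives vanishing at `x`. Over a finite-dimensional space of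
polynomials this is the nonvanishing of some determinant, hence an open condition `U s N`.

Thus `{n ≥ e}` is a finite union of countable intersections of open sets, which gives measurability.
If `n` is maximal at `x₀`, attained by `s`, every `U s N` contains `x₀`, and on their intersection
`n` is at least, hence equal to, its maximum. -/

/-! ### Krull dimension and algebraic independence -/

theorem ringKrullDim_eq_of_isIntegral_of_injective {R S : Type*} [CommRing R] [CommRing S]
    [Algebra R S] [Algebra.IsIntegral R S] (hinj : Function.Injective (algebraMap R S)) :
    ringKrullDim S = ringKrullDim R := by
  apply le_antisymm
  · refine Order.krullDim_le_of_strictMono (PrimeSpectrum.comap (algebraMap R S)) ?_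
    intro P Q hPQ
    exact Ideal.IsIntegral.comap_lt_comap (I := P.asIdeal) (J := Q.asIdeal) hPQ
  · refine iSup_le fun l => ?_
    obtain ⟨P, -, hP, hPl⟩ := Ideal.exists_ideal_over_prime_of_isIntegral (S := S)
      l.head.asIdeal ⊥ (by rw [← RingHom.ker_eq_comap_bot,
        (RingHom.injective_iff_ker_eq_bot _).mp hinj]; exact bot_le)
    have : P.LiesOver l.head.asIdeal := ⟨hPl.symm⟩
    obtain ⟨L, hL, -, -⟩ := Ideal.exists_ltSeries_of_hasGoingUp l P
    rw [← hL]
    exact Order.LTSeries.length_le_krullDim L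

section FiniteType

variable {k B : Type*} [Field k] [CommRing B] [Algebra k B]

/-- The zero ideal of the polynomial ring is a minimal prime, so it is contracted from a prime of
`B`. This reduces to domains, where transcendence degree is available. -/
theorem AlgebraicIndependent.exists_isPrime_quotient {ι : Type*} {v : ι → B}
    (hv : AlgebraicIndependent k v) :
    ∃ P : Ideal B, P.IsPrime ∧ AlgebraicIndependent k (fun i => Ideal.Quotient.mk P (v i)) := by
  have hinj : Function.Injective (MvPolynomial.aeval (R := k) v).toRingHom := hv
  obtain ⟨P, hP, hPc⟩ := Ideal.exists_comap_eq_of_mem_minimalPrimes_of_injective hinj ⊥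
    (by rw [IsDomain.minimalPrimes_eq_singleton_bot]; rfl)
  refine ⟨P, hP, ?_⟩
  rw [algebraicIndependent_iff]
  intro p hp
  have h : (Ideal.Quotient.mkₐ k P) (MvPolynomial.aeval v p) = 0 := by
    rw [← hp, ← AlgHom.comp_apply, MvPolynomial.comp_aeval]; rfl
  have h2 : p ∈ P.comap (MvPolynomial.aeval (R := k) v).toRingHom :=
    Ideal.Quotient.eq_zero_iff_mem (I := P).mp h
  rwa [hPc] at h2

variable [Algebra.FiniteType k B]

/-- Noether normalization, in terms of the Krull dimension: a nontrivial finitely generated algebra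
is integral over the subalgebra generated by `dim B` algebraically independent elements. -/
theorem exists_algebraicIndependent_isIntegral_adjoin (k B : Type*) [Field k] [CommRing B]
    [Algebra k B] [Algebra.FiniteType k B] [Nontrivial B] :
    ∃ (s : ℕ) (v : Fin s → B), ringKrullDim B = s ∧ AlgebraicIndependent k v ∧
      Algebra.IsIntegral (Algebra.adjoin k (Set.range v)) B := by
  obtain ⟨s, g, hg, hint⟩ := exists_integral_inj_algHom_of_fg k B
  refine ⟨s, fun i => g (MvPolynomial.X i), ?_, ?_, ?_⟩
  · algebraize [g.toRingHom]
    have : Algebra.IsIntegral (MvPolynomial (Fin s) k) B := ⟨hint⟩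
    rw [ringKrullDim_eq_of_isIntegral_of_injective (R := MvPolynomial (Fin s) k) hg]
    simp
  · exact (MvPolynomial.algebraicIndependent_X (Fin s) k).map' hg
  · refine ⟨fun b => ?_⟩
    have hr : (Algebra.adjoin k (Set.range fun i => g (MvPolynomial.X i))) = g.range := by
      rw [← Algebra.map_top, ← MvPolynomial.adjoin_range_X, AlgHom.map_adjoin, ← Set.range_comp]
      rfl
    rw [hr]
    obtain ⟨p, hp, hpb⟩ := hint b
    refine ⟨p.map g.rangeRestrict.toRingHom, hp.map _, ?_⟩
    rw [Polynomial.eval₂_map]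
    exact hpb

/-- In a domain quotient that keeps `v` independent, the images of the `dim B` Noether elements
bound the transcendence degree. -/
theorem AlgebraicIndependent.natCard_le_ringKrullDim {ι : Type*} [Finite ι] {v : ι → B}
    (hv : AlgebraicIndependent k v) [Nontrivial B] :
    (Nat.card ι : WithBot ℕ∞) ≤ ringKrullDim B := by
  obtain ⟨s, w, hs, -, hw⟩ := exists_algebraicIndependent_isIntegral_adjoin k B
  obtain ⟨P, hP, hvP⟩ := hv.exists_isPrime_quotient
  have hint : Algebra.IsAlgebraic
      (Algebra.adjoin k (Set.range fun i => Ideal.Quotient.mk P (w i))) (B ⧸ P) := by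
    refine ⟨fun c => IsIntegral.isAlgebraic ?_⟩
    obtain ⟨b, rfl⟩ := Ideal.Quotient.mk_surjective c
    have hr : (Algebra.adjoin k (Set.range w)).map (Ideal.Quotient.mkₐ k P) =
        Algebra.adjoin k (Set.range fun i => Ideal.Quotient.mk P (w i)) := by
      rw [AlgHom.map_adjoin, ← Set.range_comp]; rfl
    rw [← hr]
    obtain ⟨p, hp, hpb⟩ := hw.isIntegral b
    refine ⟨p.map (((Ideal.Quotient.mkₐ k P).comp (Algebra.adjoin k (Set.range w)).val).codRestrict
      ((Algebra.adjoin k (Set.range w)).map (Ideal.Quotient.mkₐ k P))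
      (fun x => ⟨x, x.2, rfl⟩)).toRingHom, hp.map _, ?_⟩
    rw [Polynomial.eval₂_map]
    have := congrArg (Ideal.Quotient.mk P) hpb
    rw [Polynomial.hom_eval₂, map_zero] at this
    exact this
  have h1 := hvP.lift_cardinalMk_le_trdeg
  have h2 := Algebra.IsAlgebraic.trdeg_le_cardinalMk k
    (Set.range fun i => Ideal.Quotient.mk P (w i))
  have h3 : Cardinal.mk (Set.range fun i => Ideal.Quotient.mk P (w i)) ≤ s := by
    simpa using Cardinal.mk_range_le_lift (f := fun i => Ideal.Quotient.mk P (w i))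
  have h4 : Cardinal.lift (Cardinal.mk ι) ≤ (s : Cardinal) := by
    refine h1.trans ?_
    simpa using h2.trans h3
  rw [hs]
  have h5 : Nat.card ι ≤ s := by
    rw [Cardinal.lift_le_nat_iff, ← Nat.cast_card] at h4
    exact_mod_cast h4
  exact_mod_cast h5

/-- The Krull dimension of a finitely generated algebra is attained by an algebraically independent
subfamily of a given family of generators. -/
theorem exists_algebraicIndependent_subfamily_generators [Nontrivial B] {ι : Type*} [Fintype ι]
    (g : ι → B) (hg : Algebra.adjoin k (Set.range g) = ⊤) :
    ∃ s : Finset ι, AlgebraicIndependent k (fun i : s => g i) ∧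
      ringKrullDim B = (s.card : WithBot ℕ∞) := by
  classical
  obtain ⟨d, w, hd, hwi, -⟩ := exists_algebraicIndependent_isIntegral_adjoin k B
  -- Since `w` survives in `B ⧸ P`, a transcendence basis drawn there from the generators has at
  -- least `dim B` elements; it lifts to an independent family in `B`.
  obtain ⟨P, hP, hwP⟩ := hwi.exists_isPrime_quotient
  have hr : Algebra.adjoin k (Set.range fun i => Ideal.Quotient.mk P (g i)) = ⊤ := by
    have : (Algebra.adjoin k (Set.range g)).map (Ideal.Quotient.mkₐ k P) =
        Algebra.adjoin k (Set.range fun i => Ideal.Quotient.mk P (g i)) := by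
      rw [AlgHom.map_adjoin, ← Set.range_comp]; rfl
    rw [← this, hg, Algebra.map_top, AlgHom.range_eq_top]
    exact Ideal.Quotient.mkₐ_surjective k P
  have halg : Algebra.IsAlgebraic
      (Algebra.adjoin k (Set.range fun i => Ideal.Quotient.mk P (g i))) (B ⧸ P) := by
    rw [hr]
    exact ⟨fun c => isAlgebraic_algebraMap (⟨c, trivial⟩ : (⊤ : Subalgebra k (B ⧸ P)))⟩
  obtain ⟨t, ht, htb⟩ := exists_isTranscendenceBasis_subset (R := k)
    (Set.range fun i => Ideal.Quotient.mk P (g i))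
  choose f hf using fun x : t => ht x.2
  have hfinj : Function.Injective f := fun x y hxy => by
    apply Subtype.ext; rw [← hf x, ← hf y, hxy]
  have : Finite t := Finite.of_injective f hfinj
  have := Fintype.ofFinite t
  have hind : AlgebraicIndependent k (fun i : t => g (f i)) := by
    refine AlgebraicIndependent.of_comp (Ideal.Quotient.mkₐ k P) ?_
    have h := htb.1
    rw [← funext hf] at h
    exact h
  have hcard : (Finset.univ.image f).card = Fintype.card t := by
    rw [Finset.card_image_of_injective _ hfinj, Finset.card_univ]
  have hmem : ∀ i : Finset.univ.image f, ∃ x : t, f x = i := fun i => by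
    have := i.2
    rw [Finset.mem_image] at this
    obtain ⟨x, -, hx⟩ := this
    exact ⟨x, hx⟩
  choose h hh using hmem
  have hs : AlgebraicIndependent k (fun i : Finset.univ.image f => g i) := by
    have hhinj : Function.Injective h := fun x y hxy => by
      apply Subtype.ext; rw [← hh x, ← hh y, hxy]
    convert hind.comp h hhinj using 1
    exact funext fun i => congrArg g (hh i).symm
  refine ⟨_, hs, le_antisymm ?_ ?_⟩
  swap
  · have h := hs.natCard_le_ringKrullDim
    rwa [Nat.card_eq_fintype_card, Fintype.card_coe] at h
  have h1 := hwP.lift_cardinalMk_le_trdeg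
  rw [← htb.cardinalMk_eq_trdeg, Cardinal.mk_fintype t, ← hcard] at h1
  rw [hd]
  have h2 : d ≤ (Finset.univ.image f).card := by simpa using h1
  exact_mod_cast h2

end FiniteType

/-! ### Dimension of a zero set of closed points -/

theorem Topology.IsInducing.isIrreducible_image_iff {X Y : Type*} [TopologicalSpace X]
    [TopologicalSpace Y] {f : X → Y} (hf : IsInducing f) {s : Set X} :
    IsIrreducible s ↔ IsIrreducible (f '' s) := by
  refine ⟨fun h => h.image f hf.continuous.continuousOn, fun ⟨hne, hpre⟩ =>
    ⟨Set.image_nonempty.mp hne, ?_⟩⟩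
  intro u v hu hv ⟨x, hxs, hxu⟩ ⟨y, hys, hyv⟩
  obtain ⟨U, hU, rfl⟩ := hf.isOpen_iff.mp hu
  obtain ⟨V, hV, rfl⟩ := hf.isOpen_iff.mp hv
  obtain ⟨_, ⟨z, hz, rfl⟩, hzU, hzV⟩ :=
    hpre U V hU hV ⟨f x, ⟨x, hxs, rfl⟩, hxu⟩ ⟨f y, ⟨y, hys, rfl⟩, hyv⟩
  exact ⟨z, hz, hzU, hzV⟩

theorem topologicalKrullDim_zeroSet {A : Type*} [CommRing A] [IsJacobsonRing A] (I : Ideal A) :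
    topologicalKrullDim (zeroSet I) = ringKrullDim (A ⧸ I) := by
  have hdim : topologicalKrullDim (PrimeSpectrum.zeroLocus (I : Set A)) = ringKrullDim (A ⧸ I) := by
    rw [ringKrullDim_quotient, topologicalKrullDim,
      ← Order.krullDim_orderDual,
      Order.krullDim_eq_of_orderIso (PrimeSpectrum.zeroLocusEquivIrreducibleCloseds (I : Set A))]
  have hind : Topology.IsInducing fun y : zeroSet I => y.1.toPrimeSpectrum :=
    (Topology.IsInducing.induced MaximalSpectrum.toPrimeSpectrum).comp Topology.IsInducing.subtypeVal
  apply le_antisymm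
  · rw [← hdim]
    exact (hind.codRestrict (s := PrimeSpectrum.zeroLocus (I : Set A))
      fun y f hf => y.2 f hf).topologicalKrullDim_le
  · rw [ringKrullDim_quotient, topologicalKrullDim, ← Order.krullDim_orderDual]
    let φ : zeroSet I → PrimeSpectrum A := fun y => y.1.toPrimeSpectrum
    have himage : ∀ P : PrimeSpectrum.zeroLocus (I : Set A),
        φ '' (φ ⁻¹' closure {P.1}) = closure {P.1} ∩ closedPoints _ := by
      rintro ⟨P, hP⟩
      rw [Set.image_preimage_eq_inter_range]
      ext Q
      simp only [Set.mem_inter_iff, mem_closedPoints_iff, Set.mem_range]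
      refine and_congr_right fun hQ => ⟨?_, fun hQc => ?_⟩
      · rintro ⟨y, rfl⟩
        exact (PrimeSpectrum.isClosed_singleton_iff_isMaximal _).mpr y.1.isMaximal
      · rw [← specializes_iff_mem_closure, ← PrimeSpectrum.le_iff_specializes] at hQ
        exact ⟨⟨⟨Q.asIdeal, (PrimeSpectrum.isClosed_singleton_iff_isMaximal _).mp hQc⟩,
          fun f hf => hQ (hP hf)⟩, rfl⟩
    -- The Jacobson property: closed points are dense in every closed set, so a prime is recovered
    -- from the maximal ideals above it.
    have hclosure : ∀ P : PrimeSpectrum.zeroLocus (I : Set A),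
        closure (φ '' (φ ⁻¹' closure {P.1})) = closure {P.1} := fun P => by
      rw [himage, JacobsonSpace.closure_inter_closedPoints isClosed_closure]
    have hirr : ∀ P : PrimeSpectrum.zeroLocus (I : Set A),
        IsIrreducible (φ ⁻¹' closure {P.1}) := fun P => by
      rw [hind.isIrreducible_image_iff, ← isIrreducible_iff_closure, hclosure]
      exact isIrreducible_singleton.closure
    let ψ : (PrimeSpectrum.zeroLocus (I : Set A))ᵒᵈ →
        TopologicalSpace.IrreducibleCloseds (zeroSet I) := fun P =>
      ⟨φ ⁻¹' closure {P.ofDual.1}, hirr P.ofDual, isClosed_closure.preimage hind.continuous⟩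
    refine Order.krullDim_le_of_strictMono ψ (Monotone.strictMono_of_injective ?_ ?_)
    · intro P Q hPQ
      have hle : Q.ofDual.1 ≤ P.ofDual.1 := hPQ
      change φ ⁻¹' closure {P.ofDual.1} ⊆ φ ⁻¹' closure {Q.ofDual.1}
      refine Set.preimage_mono (closure_minimal ?_ isClosed_closure)
      rw [Set.singleton_subset_iff, ← specializes_iff_mem_closure,
        ← PrimeSpectrum.le_iff_specializes]
      exact hle
    · intro P Q hPQ
      have hc : closure {P.ofDual.1} = closure {Q.ofDual.1} := by
        rw [← hclosure P.ofDual, ← hclosure Q.ofDual]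
        exact congrArg (fun Z => closure (φ '' Z)) (congrArg SetLike.coe hPQ)
      exact OrderDual.ofDual.injective (Subtype.ext (inseparable_iff_closure_eq.mpr hc).eq)

/-! ### Openness of the trivial common kernel condition -/

theorem MaximalSpectrum.isOpen_setOf_notMem {A : Type*} [CommRing A] (a : A) :
    IsOpen {x : MaximalSpectrum A | a ∉ x.asIdeal} :=
  (PrimeSpectrum.isOpen_basicOpen (a := a)).preimage MaximalSpectrum.toPrimeSpectrum_continuous

/-- The points at which a family of linear maps from a finite dimensional space to the regular
functions has trivial common kernel form an open set. -/
theorem isOpen_setOf_forall_exists_apply_notMem {k A V ι : Type*} [Field k] [IsAlgClosed k]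
    [CommRing A] [Algebra k A] [Algebra.FiniteType k A] [AddCommGroup V] [Module k V]
    [FiniteDimensional k V] (T : ι → V →ₗ[k] A) :
    IsOpen {x : MaximalSpectrum A | ∀ v ≠ 0, ∃ i, T i v ∉ x.asIdeal} := by
  classical
  rw [isOpen_iff_forall_mem_open]
  intro x hx
  have := x.isMaximal
  let : Field (A ⧸ x.asIdeal) := Ideal.Quotient.field x.asIdeal
  have hfin : Module.Finite k (A ⧸ x.asIdeal) := finite_of_finite_type_of_isJacobsonRing _ _
  let e : k ≃ₐ[k] (A ⧸ x.asIdeal) := AlgEquiv.ofBijective (Algebra.ofId k _)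
    IsAlgClosed.algebraMap_bijective_of_isIntegral
  let ev : A →ₗ[k] k := e.symm.toLinearMap ∘ₗ (Ideal.Quotient.mkₐ k x.asIdeal).toLinearMap
  have hev : ∀ a, ev a = 0 ↔ a ∈ x.asIdeal := fun a => by
    simp [ev, Ideal.Quotient.eq_zero_iff_mem]
  have hevmap : ∀ a, algebraMap k (A ⧸ x.asIdeal) (ev a) = Ideal.Quotient.mk x.asIdeal a :=
    fun a => e.apply_symm_apply _
  -- A trivial common kernel at `x` means that these functionals span the dual of `V`, so finitely
  -- many of them form a basis of it.
  have hspan : ⊤ ≤ Submodule.span k (Set.range fun i => ev ∘ₗ T i) := by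
    rw [← Subspace.dualCoannihilator_dualAnnihilator_eq (W := Submodule.span k _), top_le_iff]
    have : (Submodule.span k (Set.range fun i => ev ∘ₗ T i)).dualCoannihilator = ⊥ := by
      rw [eq_bot_iff]
      intro v hv
      by_contra hv0
      obtain ⟨i, hi⟩ := hx v hv0
      exact hi ((hev _).mp ((Submodule.mem_dualCoannihilator _).mp hv _
        (Submodule.subset_span ⟨i, rfl⟩)))
    rw [this, Submodule.dualAnnihilator_bot]
  let b := Module.Basis.ofSpan hspan
  have := Module.Finite.finite_basis b
  have := Fintype.ofFinite ((linearIndepOn_empty k id).extend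
    (Set.empty_subset (Set.range fun i => ev ∘ₗ T i)))
  have hb : ∀ j, ∃ i, ev ∘ₗ T i = b j := fun j => Module.Basis.ofSpan_subset hspan ⟨j, rfl⟩
  choose l hl using hb
  let c := b.dualBasis.map (Module.evalEquiv k V).symm
  have hbc : ∀ i j, b i (c j) = if i = j then 1 else 0 := fun i j => by
    have : b i (c j) = b.dualBasis j (b i) := by
      simp only [c, Module.Basis.map_apply, Module.apply_evalEquiv_symm_apply]
    rw [this, Module.Basis.dualBasis_apply_self]
  -- By duality of `b` and `c`, this matrix is the identity at `x`; wherever its determinant is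
  -- nonzero, the chosen `T (l i)` alone have trivial common kernel.
  let M : Matrix _ _ A := Matrix.of fun i j => T (l i) (c j)
  refine ⟨{y | M.det ∉ y.asIdeal}, ?_, MaximalSpectrum.isOpen_setOf_notMem _, ?_⟩
  · intro y hy v hv
    by_contra! hT
    have := y.isMaximal
    have hdet : ((Ideal.Quotient.mk y.asIdeal).mapMatrix M).det ≠ 0 := by
      rw [← RingHom.map_det]
      exact fun h => hy (Ideal.Quotient.eq_zero_iff_mem.mp h)
    have hmul : ((Ideal.Quotient.mk y.asIdeal).mapMatrix M).mulVec
        (fun j => algebraMap k (A ⧸ y.asIdeal) (c.repr v j)) = 0 := by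
      funext i
      have h : Ideal.Quotient.mk y.asIdeal (T (l i) v) = 0 :=
        Ideal.Quotient.eq_zero_iff_mem.mpr (hT _)
      rw [← c.sum_repr v] at h
      simp only [map_sum, map_smul] at h
      rw [Pi.zero_apply, ← h, Matrix.mulVec, dotProduct]
      refine Finset.sum_congr rfl fun j _ => ?_
      rw [Algebra.smul_def, map_mul, mul_comm]
      rfl
    have h0 := Matrix.eq_zero_of_mulVec_eq_zero hdet hmul
    refine hv (c.repr.map_eq_zero_iff.mp (Finsupp.ext fun j => ?_))
    exact (algebraMap k (A ⧸ y.asIdeal)).injective ((congrFun h0 j).trans (map_zero _).symm)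
  · have h1 : (Ideal.Quotient.mk x.asIdeal).mapMatrix M = 1 := by
      ext i j
      have : ev (T (l i) (c j)) = if i = j then 1 else 0 := by
        rw [← hbc, ← hl]; rfl
      simp only [RingHom.mapMatrix_apply, Matrix.map_apply, M, Matrix.of_apply]
      rw [← hevmap, this, Matrix.one_apply]
      split_ifs <;> simp
    intro h
    have := Ideal.Quotient.eq_zero_iff_mem.mpr h
    rw [RingHom.map_det, h1, Matrix.det_one] at this
    exact one_ne_zero this

/-! ### Iterated derivatives and the ideal `I(F, x)` -/

namespace AlgebraicFoliation

variable {A : Type*} [CommRing A] [Algebra ℂ A]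

/-- The differential operator obtained by composing a list of vector fields of `F`. -/
def iteratedDerivation (F : AlgebraicFoliation A) (w : List F.carrier) : A →ₗ[ℂ] A :=
  w.foldr (fun D T => T ∘ₗ D.1.toLinearMap) LinearMap.id

@[simp]
theorem iteratedDerivation_nil (F : AlgebraicFoliation A) (f : A) :
    F.iteratedDerivation [] f = f := rfl

@[simp]
theorem iteratedDerivation_cons (F : AlgebraicFoliation A) (D : F.carrier) (w : List F.carrier)
    (f : A) : F.iteratedDerivation (D :: w) f = F.iteratedDerivation w (D.1 f) := rfl

theorem mem_maxIdeal_singleton (F : AlgebraicFoliation A) (x : MaximalSpectrum A) (f : A) :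
    f ∈ F.maxIdeal {x} ↔ ∀ w, F.iteratedDerivation w f ∈ x.asIdeal := by
  have hx : pointsIdeal {x} = x.asIdeal := by simp [pointsIdeal]
  have hg := F.isGreatest_maxIdeal {x}
  constructor
  · intro hf w
    induction w generalizing f with
    | nil => exact hx ▸ hg.1.1 hf
    | cons D w ih => exact ih _ (hg.1.2 D.1 D.2 f hf)
  · intro hf
    -- By Leibniz, `D (a * g)` is a combination of `D g` and `g`, both of which satisfy the
    -- hypothesis; hence the induction quantifies over `a` and `g`.
    have hmul : ∀ (w : List F.carrier) (a g : A), (∀ w, F.iteratedDerivation w g ∈ x.asIdeal) →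
        F.iteratedDerivation w (a * g) ∈ x.asIdeal := by
      intro w
      induction w with
      | nil => exact fun a g h => x.asIdeal.mul_mem_left a (h [])
      | cons D w ih =>
        intro a g h
        rw [iteratedDerivation_cons, Derivation.leibniz, map_add, smul_eq_mul, smul_eq_mul,
          mul_comm g]
        exact add_mem (ih a _ fun w => h (D :: w)) (ih _ g h)
    let J : Ideal A :=
      { carrier := {g | ∀ w, F.iteratedDerivation w g ∈ x.asIdeal}
        add_mem' := fun ha hb w => by rw [map_add]; exact add_mem (ha w) (hb w)
        zero_mem' := fun w => by rw [map_zero]; exact zero_mem _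
        smul_mem' := fun a g hg w => hmul w a g hg }
    have hJ : J ∈ F.invariantIdeals {x} :=
      ⟨fun g hg => hx ▸ hg [], fun D hD g hg w => hg (⟨D, hD⟩ :: w)⟩
    exact hg.2 hJ hf

theorem maxIdeal_singleton_ne_top (F : AlgebraicFoliation A) (x : MaximalSpectrum A) :
    F.maxIdeal {x} ≠ ⊤ := fun h =>
  x.isMaximal.ne_top ((Ideal.eq_top_iff_one _).mpr
    ((F.mem_maxIdeal_singleton x 1).mp (h ▸ Submodule.mem_top) []))

theorem algebraicIndependent_mk_maxIdeal_iff (F : AlgebraicFoliation A) (x : MaximalSpectrum A)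
    {ι : Type*} (v : ι → A) :
    AlgebraicIndependent ℂ (fun i => Ideal.Quotient.mk (F.maxIdeal {x}) (v i)) ↔
      ∀ N, ∀ p : MvPolynomial.restrictTotalDegree ι ℂ N, p ≠ 0 →
        ∃ w, F.iteratedDerivation w (MvPolynomial.aeval v p.1) ∉ x.asIdeal := by
  have key : ∀ p : MvPolynomial ι ℂ,
      MvPolynomial.aeval (fun i => Ideal.Quotient.mk (F.maxIdeal {x}) (v i)) p = 0 ↔
        ∀ w, F.iteratedDerivation w (MvPolynomial.aeval v p) ∈ x.asIdeal := fun p => by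
    rw [← mem_maxIdeal_singleton, ← Ideal.Quotient.eq_zero_iff_mem,
      ← Ideal.Quotient.mkₐ_eq_mk ℂ, ← AlgHom.comp_apply, MvPolynomial.comp_aeval]
  rw [algebraicIndependent_iff]
  constructor
  · intro h N p hp
    by_contra! hw
    exact hp (Subtype.ext (h p.1 ((key _).mpr hw)))
  · intro h p hp
    by_contra hp0
    obtain ⟨w, hw⟩ := h p.totalDegree
      ⟨p, (MvPolynomial.mem_restrictTotalDegree ..).mpr le_rfl⟩ (fun h => hp0 (congrArg Subtype.val h))
    exact hw ((key p).mp hp w)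

/-- The independence of a finite family of functions modulo `I(F, x)` is, as a condition on `x`,
a countable intersection of open conditions. -/
theorem exists_isOpen_setOf_algebraicIndependent_eq_iInter [Algebra.FiniteType ℂ A]
    (F : AlgebraicFoliation A) {ι : Type*} [Finite ι] (v : ι → A) :
    ∃ U : ℕ → Set (MaximalSpectrum A), (∀ N, IsOpen (U N)) ∧
      {x | AlgebraicIndependent ℂ (fun i => Ideal.Quotient.mk (F.maxIdeal {x}) (v i))} =
        ⋂ N, U N := by
  refine ⟨fun N => {x | ∀ p : MvPolynomial.restrictTotalDegree ι ℂ N, p ≠ 0 →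
    ∃ w, F.iteratedDerivation w (MvPolynomial.aeval v p.1) ∉ x.asIdeal}, fun N => ?_, ?_⟩
  · have : FiniteDimensional ℂ (MvPolynomial.restrictTotalDegree ι ℂ N) := inferInstance
    exact isOpen_setOf_forall_exists_apply_notMem fun w => F.iteratedDerivation w ∘ₗ
      (MvPolynomial.aeval v).toLinearMap ∘ₗ (MvPolynomial.restrictTotalDegree ι ℂ N).subtype
  · ext x
    simp only [Set.mem_ofPred_eq, Set.mem_iInter, algebraicIndependent_mk_maxIdeal_iff]

end AlgebraicFoliation

/-! ### Measurability and the generic value -/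

theorem theorem2 {A : Type*} [CommRing A] [IsDomain A] [Algebra ℂ A] [Algebra.FiniteType ℂ A]
    (F : AlgebraicFoliation A) :
    ∃ n : MaximalSpectrum A → ℕ,
      (∀ x, topologicalKrullDim (F.minimalInvariantVariety {x}) = (n x : WithBot ℕ∞)) ∧
      ZariskiMeasurable n ∧
      ∃ p : ℕ, (∀ x, n x ≤ p) ∧ VeryGenerically (fun x => n x = p) ∧ ∃ x, n x = p := by
  have hjac : IsJacobsonRing A := isJacobsonRing_of_finiteType (A := ℂ)
  have hnt : ∀ x, Nontrivial (A ⧸ F.maxIdeal {x}) := fun x =>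
    Ideal.Quotient.nontrivial_iff.mpr (F.maxIdeal_singleton_ne_top x)
  have hft : ∀ x, Algebra.FiniteType ℂ (A ⧸ F.maxIdeal {x}) := fun x => inferInstance
  obtain ⟨m, g, hg⟩ : ∃ (m : ℕ) (g : Fin m → A), Algebra.adjoin ℂ (Set.range g) = ⊤ := by
    obtain ⟨s, hs⟩ := (Algebra.FiniteType.out : (⊤ : Subalgebra ℂ A).FG)
    refine ⟨s.card, fun i => s.equivFin.symm i, ?_⟩
    rw [← hs]
    congr 1
    ext a
    constructor
    · rintro ⟨i, rfl⟩; exact (s.equivFin.symm i).2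
    · intro ha; exact ⟨s.equivFin ⟨a, ha⟩, by simp⟩
  have hgen : ∀ x, Algebra.adjoin ℂ
      (Set.range fun i => Ideal.Quotient.mk (F.maxIdeal {x}) (g i)) = ⊤ := fun x => by
    have : (Algebra.adjoin ℂ (Set.range g)).map (Ideal.Quotient.mkₐ ℂ (F.maxIdeal {x})) =
        Algebra.adjoin ℂ (Set.range fun i => Ideal.Quotient.mk (F.maxIdeal {x}) (g i)) := by
      rw [AlgHom.map_adjoin, ← Set.range_comp]; rfl
    rw [← this, hg, Algebra.map_top, AlgHom.range_eq_top]
    exact Ideal.Quotient.mkₐ_surjective ℂ _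
  -- The choice of `S x` has no regularity in `x`; only its cardinality matters, being the maximum
  -- over the subfamilies independent at `x` (`hmem`, `hle`).
  choose S hSind hSdim using fun x =>
    exists_algebraicIndependent_subfamily_generators (k := ℂ) _ (hgen x)
  choose U hUo hUeq using fun s : Finset (Fin m) =>
    F.exists_isOpen_setOf_algebraicIndependent_eq_iInter (fun i : s => g i)
  have hmem : ∀ x, x ∈ ⋂ N, U (S x) N := fun x => by
    rw [← hUeq]; exact hSind x
  have hle : ∀ s x, x ∈ ⋂ N, U s N → s.card ≤ (S x).card := fun s x hx => by
    rw [← hUeq] at hx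
    have h := AlgebraicIndependent.natCard_le_ringKrullDim hx
    rw [hSdim, Nat.card_eq_fintype_card, Fintype.card_coe] at h
    exact_mod_cast h
  refine ⟨fun x => (S x).card, fun x => ?_, fun d => ?_, ?_⟩
  · rw [AlgebraicFoliation.minimalInvariantVariety, topologicalKrullDim_zeroSet, hSdim]
  · let : MeasurableSpace (MaximalSpectrum A) :=
      MeasurableSpace.generateFrom {U : Set (MaximalSpectrum A) | IsOpen U}
    have hge : ∀ e, MeasurableSet {x | e ≤ (S x).card} := fun e => by
      have : {x | e ≤ (S x).card} = ⋃ s ∈ {s : Finset (Fin m) | e ≤ s.card}, ⋂ N, U s N := by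
        ext x
        simp only [Set.mem_ofPred_eq, Set.mem_iUnion]
        exact ⟨fun h => ⟨S x, h, hmem x⟩, fun ⟨s, hs, hx⟩ => hs.trans (hle s x hx)⟩
      rw [this]
      exact MeasurableSet.biUnion (Set.to_countable _) fun s _ => MeasurableSet.iInter fun N =>
        MeasurableSpace.measurableSet_generateFrom (hUo s N)
    have : (fun x => (S x).card) ⁻¹' {d} = {x | d ≤ (S x).card} \ {x | d + 1 ≤ (S x).card} := by
      ext x
      simp only [Set.mem_preimage, Set.mem_singleton_iff, Set.mem_sdiff, Set.mem_ofPred_eq]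
      omega
    rw [this]
    exact (hge d).diff (hge (d + 1))
  · have hfin : (Set.range fun x => (S x).card).Finite :=
      (Set.finite_Iic m).subset (by rintro _ ⟨x, rfl⟩; simpa using (S x).card_le_univ)
    have hne : (Set.range fun x => (S x).card).Nonempty := Set.range_nonempty _
    obtain ⟨_, ⟨x, rfl⟩, hx⟩ := hfin.exists_maximalFor id _ hne
    have hmax : ∀ y, (S y).card ≤ (S x).card := fun y => by
      rcases le_total (S y).card (S x).card with h | h
      · exact h
      · exact hx ⟨y, rfl⟩ h
    refine ⟨(S x).card, hmax, ⟨U (S x), fun N => ⟨hUo _ N, x, Set.mem_iInter.mp (hmem x) N⟩,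
      fun y hy => le_antisymm (hmax y) (hle _ y hy)⟩, x, rfl⟩
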